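/- Let $(R,m)$ be a Cohen–Macaulay (Noetherian) local ring of dimension $d\ge 2$ and let $I$ be an $m$-primary ideal of $R$. Let $G(I)=\bigoplus_{n\ge 0} I^n/I^{n+1}$ be the associated graded ring and $F(I)=\bigoplus_{n\ge 0} I^n/mI^n$ the fiber cone of $I$; by the depth of $F(I)$ we mean the depth of its ideal $F(I)_+=\bigoplus_{n\ge 1}I^n/mI^n$, i.e. the supremum of the lengths of $F(I)$-regular sequences in $F(I)_+$. Let $x\in m$ and $a_1,\dots,a_{d-1}\in I$ be such that $(x,a_1,\dots,a_{d-1})$ is a joint reduction of the ideals $(m,I,\dots,I)$ ($I$ repeated $d-1$ times), that is, for some integer $n\ge 1$, $$\Bigl[x\,I^{d-1}+\sum_{j=1}^{d-1}a_j\,m\,I^{d-2}\Bigr](mI^{d-1})^{n-1}=(mI^{d-1})^{n}.$$ Put $J=(a_1,\dots,a_{d-1})$. Suppose that (i) $mI^2=xI^2+JmI$, and (ii) the residue classes $a_1^o,\dots,a_{d-1}^o$ of $a_1,\dots,a_{d-1}$ in $I/I^2$, the degree-one component of $G(I)$, form a regular sequence in $G(I)$. Then $\operatorname{depth}F(I)\ge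 d-1$. -/

import Mathlib

open scoped DirectSum

noncomputable section

namespace BlowupAlgebra

universe u

/-! ### Depth and Cohen–Macaulay local rings -/

/-- The depth (grade) of an ideal `𝔞` of `A`: the supremum of the lengths of the `A`-regular
sequences consisting of elements of `𝔞`. -/
def depth {A : Type u} [CommRing A] (𝔞 : Ideal A) : ℕ∞ :=
  ⨆ (rs : List A) (_ : RingTheory.Sequence.IsRegular A rs ∧ ∀ r ∈ rs, r ∈ 𝔞), (rs.length : ℕ∞)

/-- A Noetherian local ring is Cohen–Macaulay if the depth of its maximal ideal is its Krull
dimension. -/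
structure IsCohenMacaulayLocal (R : Type u) [CommRing R] [IsLocalRing R] : Prop where
  noetherian : IsNoetherianRing R
  depth_eq : (depth (IsLocalRing.maximalIdeal R) : WithBot ℕ∞) = ringKrullDim R

/-! ### Joint reductions -/

/-- A family `x` of elements is a joint reduction of a finite family `I` of ideals if `x i ∈ I i`
for all `i`, and for some positive `n`,
`[∑ j, x j ∏_{i ≠ j} I i] (∏ i, I i) ^ (n - 1) = (∏ i, I i) ^ n`. -/
def IsJointReduction {R : Type u} [CommRing R] {ι : Type*} [Fintype ι] [DecidableEq ι]
    (I : ι → Ideal R) (x : ι → R) : Prop :=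
  (∀ i, x i ∈ I i) ∧ ∃ n : ℕ, 0 < n ∧
    (∑ j, Ideal.span {x j} * ∏ i ∈ Finset.univ.erase j, I i) * (∏ i, I i) ^ (n - 1) =
      (∏ i, I i) ^ n

/-! ### The graded rings `⨁ n, I ^ n / K I ^ n` -/

section Graded

variable {R : Type u} [CommRing R]

/-- The `R`-module `I ^ n / K I ^ n`. -/
abbrev Piece (K I : Ideal R) (n : ℕ) : Type u :=
  (I ^ n : Ideal R) ⧸ Submodule.submoduleOf (K * I ^ n) (I ^ n)

variable (K I : Ideal R)

/-- The class in `I ^ n / K I ^ n` of an element of `I ^ n`. -/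
def Piece.mk (n : ℕ) (a : (I ^ n : Ideal R)) : Piece K I n :=
  Submodule.Quotient.mk a

theorem Piece.mk_eq_mk_iff {n : ℕ} (a b : (I ^ n : Ideal R)) :
    Piece.mk K I n a = Piece.mk K I n b ↔ (a : R) - b ∈ K * I ^ n :=
  Submodule.Quotient.eq _

theorem Piece.mk_surjective (n : ℕ) : Function.Surjective (Piece.mk K I n) :=
  Submodule.Quotient.mk_surjective _

/-- The product of an element of `I ^ i` and one of `I ^ j`, as an element of `I ^ (i + j)`. -/
def powMul {i j : ℕ} (a : (I ^ i : Ideal R)) (b : (I ^ j : Ideal R)) : (I ^ (i + j) : Ideal R) :=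
  ⟨(a : R) * b, by rw [pow_add]; exact Ideal.mul_mem_mul a.2 b.2⟩

/-- Multiplication `I ^ i / K I ^ i × I ^ j / K I ^ j → I ^ (i + j) / K I ^ (i + j)`, induced by
the multiplication of `R`. -/
def Piece.mul {i j : ℕ} (a : Piece K I i) (b : Piece K I j) : Piece K I (i + j) :=
  Quotient.liftOn₂' a b (fun a b => Piece.mk K I (i + j) (powMul I a b)) (by
    intro a b a' b' ha hb
    have ha' : (a : R) - a' ∈ K * I ^ i := (Submodule.quotientRel_def (Submodule.submoduleOf (K * I ^ i) (I ^ i))).1 ha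
    have hb' : (b : R) - b' ∈ K * I ^ j := (Submodule.quotientRel_def (Submodule.submoduleOf (K * I ^ j) (I ^ j))).1 hb
    rw [Piece.mk_eq_mk_iff]
    have h : (a : R) * b - a' * b' = (a - a') * b + (b - b') * a' := by ring
    change (a : R) * b - a' * b' ∈ K * I ^ (i + j)
    rw [h, pow_add]
    refine add_mem ?_ ?_
    · rw [← mul_assoc]
      exact Ideal.mul_mem_mul ha' b.2
    · rw [mul_comm (I ^ i), ← mul_assoc]
      exact Ideal.mul_mem_mul hb' a'.2)

theorem Piece.mk_mul_mk {i j : ℕ} (a : (I ^ i : Ideal R)) (b : (I ^ j : Ideal R)) :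
    Piece.mul K I (Piece.mk K I i a) (Piece.mk K I j b) = Piece.mk K I (i + j) (powMul I a b) :=
  rfl

theorem Piece.sigma_ext {i j : ℕ} (h : i = j) (a : (I ^ i : Ideal R)) (b : (I ^ j : Ideal R))
    (hab : (a : R) = b) :
    (⟨i, Piece.mk K I i a⟩ : GradedMonoid (Piece K I)) = ⟨j, Piece.mk K I j b⟩ := by
  subst h
  rw [Subtype.ext hab]

/-- The class of an element of `R` in the degree zero piece. -/
def Piece.zeroDeg (r : R) : Piece K I 0 := Piece.mk K I 0 ⟨r, by simp⟩

theorem Piece.zeroDeg_add (r s : R) :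
    Piece.zeroDeg K I (r + s) = Piece.zeroDeg K I r + Piece.zeroDeg K I s := rfl

theorem Piece.zeroDeg_neg (r : R) : Piece.zeroDeg K I (-r) = -Piece.zeroDeg K I r := rfl

instance gOne : GradedMonoid.GOne (Piece K I) := ⟨Piece.zeroDeg K I 1⟩

instance gMul : GradedMonoid.GMul (Piece K I) := ⟨Piece.mul K I⟩

instance gCommRing : DirectSum.GCommRing (Piece K I) where
  __ := gOne K I
  __ := gMul K I
  mul_zero {i j} a := by
    obtain ⟨a, rfl⟩ := Piece.mk_surjective K I i a
    refine (Piece.mk_eq_mk_iff K I (powMul I a (0 : (I ^ j : Ideal R))) 0).2 ?_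
    simp [powMul]
  zero_mul {i j} b := by
    obtain ⟨b, rfl⟩ := Piece.mk_surjective K I j b
    refine (Piece.mk_eq_mk_iff K I (powMul I (0 : (I ^ i : Ideal R)) b) 0).2 ?_
    simp [powMul]
  mul_add {i j} a b c := by
    obtain ⟨a, rfl⟩ := Piece.mk_surjective K I i a
    obtain ⟨b, rfl⟩ := Piece.mk_surjective K I j b
    obtain ⟨c, rfl⟩ := Piece.mk_surjective K I j c
    refine (Piece.mk_eq_mk_iff K I (powMul I a (b + c)) (powMul I a b + powMul I a c)).2 ?_
    simp [powMul, _root_.mul_add]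
  add_mul {i j} a b c := by
    obtain ⟨a, rfl⟩ := Piece.mk_surjective K I i a
    obtain ⟨b, rfl⟩ := Piece.mk_surjective K I i b
    obtain ⟨c, rfl⟩ := Piece.mk_surjective K I j c
    refine (Piece.mk_eq_mk_iff K I (powMul I (a + b) c) (powMul I a c + powMul I b c)).2 ?_
    simp [powMul, _root_.add_mul]
  one_mul := by
    rintro ⟨i, a⟩
    obtain ⟨a, rfl⟩ := Piece.mk_surjective K I i a
    exact Piece.sigma_ext K I (zero_add i) (powMul I ⟨1, by simp⟩ a) a (one_mul (a : R))
  mul_one := by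
    rintro ⟨i, a⟩
    obtain ⟨a, rfl⟩ := Piece.mk_surjective K I i a
    exact Piece.sigma_ext K I (add_zero i) (powMul I a ⟨1, by simp⟩) a (mul_one (a : R))
  mul_assoc := by
    rintro ⟨i, a⟩ ⟨j, b⟩ ⟨k, c⟩
    obtain ⟨a, rfl⟩ := Piece.mk_surjective K I i a
    obtain ⟨b, rfl⟩ := Piece.mk_surjective K I j b
    obtain ⟨c, rfl⟩ := Piece.mk_surjective K I k c
    exact Piece.sigma_ext K I (add_assoc i j k) (powMul I (powMul I a b) c)
      (powMul I a (powMul I b c)) (mul_assoc (a : R) b c)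
  mul_comm := by
    rintro ⟨i, a⟩ ⟨j, b⟩
    obtain ⟨a, rfl⟩ := Piece.mk_surjective K I i a
    obtain ⟨b, rfl⟩ := Piece.mk_surjective K I j b
    exact Piece.sigma_ext K I (add_comm i j) (powMul I a b) (powMul I b a) (mul_comm (a : R) b)
  natCast n := Piece.zeroDeg K I n
  natCast_zero := (Piece.mk_eq_mk_iff K I ⟨((0 : ℕ) : R), by simp⟩ 0).2 (by simp)
  natCast_succ n := by
    rw [Nat.cast_succ, Piece.zeroDeg_add]
    rfl
  intCast n := Piece.zeroDeg K I n
  intCast_ofNat n := (Piece.mk_eq_mk_iff K I ⟨((n : ℤ) : R), by simp⟩ ⟨(n : R), by simp⟩).2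
    (by simp)
  intCast_negSucc_ofNat n := by
    rw [Int.cast_negSucc, Piece.zeroDeg_neg]

/-- The graded ring `⨁ n, I ^ n / K I ^ n`. -/
abbrev BlowupRing : Type u := ⨁ n, Piece K I n

/-- The ideal of `⨁ n, I ^ n / K I ^ n` generated by the homogeneous elements of positive
degree. -/
def irrelevantIdeal : Ideal (BlowupRing K I) :=
  Ideal.span {f | ∃ (n : ℕ) (z : Piece K I n), 0 < n ∧ f = DirectSum.of (Piece K I) n z}

/-- The class of `a ∈ I` in the degree one piece `I / K I`, as an element of
`⨁ n, I ^ n / K I ^ n`. -/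
def degreeOne (a : R) (ha : a ∈ I) : BlowupRing K I :=
  DirectSum.of (Piece K I) 1 (Piece.mk K I 1 ⟨a, by rwa [pow_one]⟩)

/-- The associated graded ring `G(I) = ⨁ n, I ^ n / I ^ (n + 1)`; note `I * I ^ n = I ^ (n + 1)`. -/
abbrev AssociatedGraded : Type u := BlowupRing I I

/-- The residue class of `a ∈ I` in `I / I ^ 2`, the degree one component of `G(I)`. -/
abbrev initialForm (a : R) (ha : a ∈ I) : AssociatedGraded I := degreeOne I I a ha

/-- The fiber cone `F(I) = ⨁ n, I ^ n / m I ^ n`, where `m` is the maximal ideal. -/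
abbrev FiberCone [IsLocalRing R] : Type u := BlowupRing (IsLocalRing.maximalIdeal R) I

/-- The depth of the fiber cone: the depth of the ideal of `F(I)` generated by the elements of
positive degree (its homogeneous maximal ideal when `I` is a proper ideal). -/
def fiberConeDepth [IsLocalRing R] : ℕ∞ :=
  depth (A := FiberCone I) (irrelevantIdeal (IsLocalRing.maximalIdeal R) I)

end Graded

end BlowupAlgebra

end

universe u

open RingTheory.Sequence BlowupAlgebra

/-! Write `J_k = (a₁, …, a_k)` and `J = J_{d-1}`. Regularity in `G(I)` gives the Valabrega–Valla
equalities `J_k ∩ I^(n+1) = J_k I^n` (`initialSpan_inf_pow_le`) and, by Krull's intersection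
theorem, regularity of `a` in `R`. The classes of `a` then form a regular sequence in `F(I)` once `J
∩ m I^(n+1) = J m I^n` for all `n` (`mem_initialIdeal_of_mul_mem`).

For `n ≥ 1`, (i) gives `m I^(n+1) = x I^(n+1) + J m I^n`. It also makes `(x) + J` an `m`-primary
ideal, so `x` is a nonzerodivisor modulo `J` because `R` is Cohen–Macaulay
(`mem_ofList_of_mul_mem`). If `x y ∈ J` with `y ∈ I^(n+1)`, then `y ∈ J ∩ I^(n+1) = J I^n`, whence
`x y ∈ J m I^n`.

For `n = 0`, a failure would make some `a_j` redundant modulo `m I`; by Nakayama, `x` and the other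
`a_i` would generate an `m`-primary ideal with too few generators for the dimension
(`span_inf_maximalIdeal_mul_le`). -/

/-! ### Depth of quotients by regular sequences -/

-- The vanishing range of Ext detects depth, and the long exact sequence of `0 → M → M → M/aM → 0`
-- shortens it by at most one. So `a` need not belong to the given sequence.
open CategoryTheory Abelian Limits ModuleCat in
theorem exists_isRegular_quotSMulTop {R : Type u} [CommRing R] [IsNoetherianRing R]
    {𝔞 : Ideal R} (h𝔞 : 𝔞 ≤ Ideal.jacobson ⊥) {M : Type u} [AddCommGroup M] [Module R M]
    [Module.Finite R M] [Nontrivial M] {n : ℕ}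
    (h : ∃ rs : List R, rs.length = n + 1 ∧ (∀ r ∈ rs, r ∈ 𝔞) ∧ IsRegular M rs)
    {a : R} (ha : a ∈ 𝔞) (hreg : IsSMulRegular M a) :
    ∃ rs : List R, rs.length = n ∧ (∀ r ∈ rs, r ∈ 𝔞) ∧ IsRegular (QuotSMulTop a M) rs := by
  have lt (N : Type u) [AddCommGroup N] [Module R N] [Module.Finite R N] [Nontrivial N] :
      𝔞 • (⊤ : Submodule R N) < ⊤ :=
    lt_top_iff_ne_top.2 (Submodule.top_ne_ideal_smul_of_le_jacobson_annihilator
      (h𝔞.trans (Ideal.jacobson_mono bot_le))).symm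
  have hN : Nontrivial (QuotSMulTop a M) := by
    refine Submodule.Quotient.nontrivial_iff.mpr
      (Submodule.top_ne_pointwise_smul_of_mem_jacobson_annihilator ?_).symm
    exact Ideal.jacobson_mono bot_le (h𝔞 ha)
  have h1 := ((exists_isRegular_tfae 𝔞 (n + 1) (ModuleCat.of R M) (lt M)).out 3 1).1 h
  refine ((exists_isRegular_tfae 𝔞 n (ModuleCat.of R (QuotSMulTop a M))
    (lt (QuotSMulTop a M))).out 1 3).1 fun i hi => ?_
  have zero1 := AddCommGrpCat.isZero_of_iff_subsingleton.mpr (h1 i (by omega))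
  have zero2 := AddCommGrpCat.isZero_of_iff_subsingleton.mpr (h1 (i + 1) (by omega))
  have reg : IsSMulRegular (ModuleCat.of R M) a := hreg
  exact AddCommGrpCat.subsingleton_of_isZero <| ShortComplex.Exact.isZero_of_both_zeros
    ((Ext.covariant_sequence_exact₃' _ reg.smulShortComplex_shortExact) i (i + 1) rfl)
    (zero1.eq_zero_of_src _) (zero2.eq_zero_of_tgt _)

theorem exists_isRegular_quotient_ofList {R : Type u} [CommRing R] [IsNoetherianRing R]
    {𝔞 : Ideal R} (h𝔞 : 𝔞 ≤ Ideal.jacobson ⊥) (n : ℕ) (as : List R) (has : ∀ a ∈ as, a ∈ 𝔞) :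
    ∀ {M : Type u} [AddCommGroup M] [Module R M] [Module.Finite R M] [Nontrivial M],
    (∃ rs : List R, rs.length = n + as.length ∧ (∀ r ∈ rs, r ∈ 𝔞) ∧ IsRegular M rs) →
    IsWeaklyRegular M as →
    ∃ rs : List R, rs.length = n ∧ (∀ r ∈ rs, r ∈ 𝔞) ∧
      IsRegular (M ⧸ (Ideal.ofList as • ⊤ : Submodule R M)) rs := by
  induction as with
  | nil =>
    rintro M _ _ _ _ ⟨rs, h1, h2, h3⟩ -
    refine ⟨rs, h1, h2, ?_⟩
    refine (LinearEquiv.isRegular_congr (Submodule.quotEquivOfEqBot _ ?_) rs).2 h3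
    rw [Ideal.ofList_nil, Submodule.bot_smul]
  | cons a as ih =>
    intro M _ _ _ _ h hreg
    rw [isWeaklyRegular_cons_iff] at hreg
    have ha := has a List.mem_cons_self
    have hN : Nontrivial (QuotSMulTop a M) := by
      refine Submodule.Quotient.nontrivial_iff.mpr
        (Submodule.top_ne_pointwise_smul_of_mem_jacobson_annihilator ?_).symm
      exact Ideal.jacobson_mono bot_le (h𝔞 ha)
    obtain ⟨rs, h1, h2, h3⟩ := ih (fun b hb => has b (List.mem_cons_of_mem _ hb))
      (M := QuotSMulTop a M) (exists_isRegular_quotSMulTop h𝔞 h ha hreg.1) hreg.2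
    exact ⟨rs, h1, h2, (LinearEquiv.isRegular_congr
      (Submodule.quotOfListConsSMulTopEquivQuotSMulTopInner M a as) rs).2 h3⟩

/-- In a Noetherian local ring, regular sequences in the maximal ideal can be replaced by regular
sequences of the same length in any proper ideal whose radical is the maximal ideal. -/
theorem exists_isRegular_of_radical_eq_maximalIdeal {R : Type u} [CommRing R] [IsLocalRing R]
    [IsNoetherianRing R] {𝔞 : Ideal R} (h𝔞 : 𝔞.radical = IsLocalRing.maximalIdeal R) {n : ℕ}
    (h : ∃ rs : List R, rs.length = n ∧ (∀ r ∈ rs, r ∈ IsLocalRing.maximalIdeal R) ∧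
      IsRegular R rs) :
    ∃ rs : List R, rs.length = n ∧ (∀ r ∈ rs, r ∈ 𝔞) ∧ IsRegular R rs := by
  have lt {𝔟 : Ideal R} (h : 𝔟 ≤ IsLocalRing.maximalIdeal R) : 𝔟 • (⊤ : Submodule R R) < ⊤ := by
    rw [smul_eq_mul, Ideal.mul_top]
    exact lt_top_iff_ne_top.2 (ne_top_of_le_ne_top Ideal.IsPrime.ne_top' h)
  have e := (ModuleCat.exists_isRegular_tfae 𝔞 n (ModuleCat.of R R)
    (lt (𝔞.le_radical.trans h𝔞.le))).out 2 3
  -- The residue field is a test module for both ideals, since `V(𝔞) = V(m)` is its support.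
  refine e.1 ⟨ModuleCat.of R (R ⧸ IsLocalRing.maximalIdeal R), inferInstance, inferInstance, ?_, ?_⟩
  · rw [Module.support_eq_zeroLocus, Ideal.annihilator_quotient, ← h𝔞,
      PrimeSpectrum.zeroLocus_radical]
  · have e' := (ModuleCat.exists_isRegular_tfae (IsLocalRing.maximalIdeal R) n (ModuleCat.of R R)
      (lt le_rfl)).out 3 0
    refine e'.1 h _ inferInstance inferInstance ?_
    rw [Module.support_eq_zeroLocus, Ideal.annihilator_quotient]

/-- If a Noetherian local ring has a regular sequence of length `as.length + 1`, then every
parameter modulo the ideal generated by a regular sequence `as` is a nonzerodivisor. -/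
theorem mem_ofList_of_mul_mem {R : Type u} [CommRing R] [IsLocalRing R] [IsNoetherianRing R]
    {x : R} {as : List R} (hreg : IsWeaklyRegular R as)
    (hrad : (Ideal.span {x} ⊔ Ideal.ofList as).radical = IsLocalRing.maximalIdeal R)
    (h : ∃ rs : List R, rs.length = as.length + 1 ∧ (∀ r ∈ rs, r ∈ IsLocalRing.maximalIdeal R) ∧
      IsRegular R rs) {z : R} (hz : x * z ∈ Ideal.ofList as) : z ∈ Ideal.ofList as := by
  have hle : Ideal.span {x} ⊔ Ideal.ofList as ≤ Ideal.jacobson ⊥ :=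
    (Ideal.le_radical.trans hrad.le).trans (IsLocalRing.maximalIdeal_le_jacobson _)
  obtain ⟨rs, h1, h2, h3⟩ := exists_isRegular_quotient_ofList hle 1 as
    (fun a ha => Ideal.mem_sup_right (Ideal.subset_span ha)) (M := R)
    (by rw [add_comm]; exact exists_isRegular_of_radical_eq_maximalIdeal hrad h) hreg
  obtain ⟨r, rfl⟩ := List.length_eq_one_iff.1 h1
  have h4 := (isWeaklyRegular_singleton_iff _ r).1 h3.1
  -- The regular element has the form `c x + j` with `j ∈ (as)`, so it sends `z` into `(as)` as soon
  -- as `x` does.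
  obtain ⟨y, hy, j, hj, rfl⟩ := Submodule.mem_sup.1 (h2 r (List.mem_singleton_self r))
  obtain ⟨c, rfl⟩ := Ideal.mem_span_singleton'.1 hy
  rw [isSMulRegular_quotient_iff_mem_of_smul_mem] at h4
  simp only [smul_eq_mul, Ideal.mul_top] at h4
  refine h4 z ?_
  have : (c * x + j) * z = c * (x * z) + z * j := by ring
  rw [this]
  exact add_mem (Ideal.mul_mem_left _ _ hz) (Ideal.mul_mem_left _ _ hj)

/-! ### Initial segments of a sequence -/

/-- The ideal generated by the first `k` entries of a finite sequence. -/
def initialSpan {A : Type*} [CommRing A] {r : ℕ} (f : Fin r → A) (k : ℕ) : Ideal A :=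
  Ideal.span (f '' {j | (j : ℕ) < k})

section InitialSpan

variable {A : Type*} [CommRing A] {r : ℕ} (f : Fin r → A)

theorem initialSpan_zero : initialSpan f 0 = ⊥ := by
  simp [initialSpan]

theorem initialSpan_succ {k : ℕ} (hk : k < r) :
    initialSpan f (k + 1) = initialSpan f k ⊔ Ideal.span {f ⟨k, hk⟩} := by
  rw [initialSpan, initialSpan, ← Ideal.span_union, ← Set.image_singleton, ← Set.image_union]
  congr 2
  ext j
  simp only [Set.mem_ofPred_eq, Set.mem_union, Set.mem_singleton_iff, Fin.ext_iff]
  omega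

theorem initialSpan_eq_span_range : initialSpan f r = Ideal.span (Set.range f) := by
  rw [initialSpan, ← Set.image_univ]
  congr 2
  ext j
  simp

theorem initialSpan_le_succ (k : ℕ) : initialSpan f k ≤ initialSpan f (k + 1) :=
  Ideal.span_mono (Set.image_mono fun _ h => Nat.lt_succ_of_lt h)

theorem apply_mem_initialSpan_succ {k : ℕ} (hk : k < r) :
    f ⟨k, hk⟩ ∈ initialSpan f (k + 1) :=
  Ideal.subset_span ⟨⟨k, hk⟩, Nat.lt_succ_self k, rfl⟩

theorem initialSpan_le {I : Ideal A} (hf : ∀ i, f i ∈ I) (k : ℕ) : initialSpan f k ≤ I :=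
  Ideal.span_le.2 (by rintro _ ⟨j, -, rfl⟩; exact hf j)

theorem ofList_take_ofFn (k : ℕ) :
    Ideal.ofList ((List.ofFn f).take k) = initialSpan f k := by
  refine congrArg Ideal.span ?_
  ext y
  simp only [List.mem_take_iff_getElem, Set.mem_ofPred_eq, Set.mem_image, List.getElem_ofFn,
    List.length_ofFn]
  constructor
  · rintro ⟨i, hi, rfl⟩
    exact ⟨⟨i, by omega⟩, by simp; omega, rfl⟩
  · rintro ⟨i, hi, rfl⟩
    exact ⟨i, by omega, rfl⟩

theorem isWeaklyRegular_ofFn_iff :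
    IsWeaklyRegular A (List.ofFn f) ↔
      ∀ k (hk : k < r) z, f ⟨k, hk⟩ * z ∈ initialSpan f k → z ∈ initialSpan f k := by
  rw [isWeaklyRegular_iff]
  simp only [isSMulRegular_quotient_iff_mem_of_smul_mem, ofList_take_ofFn, smul_eq_mul,
    Ideal.mul_top, List.length_ofFn, List.getElem_ofFn]

end InitialSpan

/-! ### Valabrega–Valla conditions -/

section Filtration

variable {R : Type*} [CommRing R]

/-- The elements of `I ^ n` whose class in `I ^ n / K I ^ n` lies in the ideal generated by the
degree one classes of the elements of `J`. -/
def initialIdeal (K I J : Ideal R) : ℕ → Ideal R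
  | 0 => K
  | n + 1 => J * I ^ n ⊔ K * I ^ (n + 1)

variable {I : Ideal R} {r : ℕ} {a : Fin r → R}

theorem mul_pow_le_initialIdeal (K I J : Ideal R) (n : ℕ) : K * I ^ n ≤ initialIdeal K I J n := by
  cases n with
  | zero => simp [initialIdeal]
  | succ n => exact le_sup_right

/-- The Valabrega–Valla condition for a sequence whose initial forms are a regular sequence. -/
theorem initialSpan_inf_pow_le (ha : ∀ i, a i ∈ I)
    (h : ∀ k (hk : k < r) n, ∀ z ∈ I ^ n, a ⟨k, hk⟩ * z ∈ initialIdeal I I (initialSpan a k) (n + 1) →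
      z ∈ initialIdeal I I (initialSpan a k) n)
    {k : ℕ} (hk : k ≤ r) (n : ℕ) :
    initialSpan a k ⊓ I ^ (n + 1) ≤ initialSpan a k * I ^ n := by
  induction k generalizing n with
  | zero => simp [initialSpan_zero]
  | succ k ih =>
    rintro u ⟨huJ, huI⟩
    -- Inside the induction on `k`, the power of `I` is raised one step at a time.
    suffices ∀ j ≤ n, u ∈ initialSpan a (k + 1) * I ^ j from this n le_rfl
    intro j
    induction j with
    | zero => intro _; simpa using huJ
    | succ j ihj =>
      intro hj
      have hu := ihj (by omega)
      rw [initialSpan_succ a hk, Ideal.sup_mul] at hu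
      obtain ⟨v, hv, _, hw, rfl⟩ := Submodule.mem_sup.1 hu
      obtain ⟨z, hz, rfl⟩ := Ideal.mem_span_singleton_mul.1 hw
      have huI' := Ideal.pow_le_pow_right (show j + 1 + 1 ≤ n + 1 by omega) huI
      have hzS : z ∈ initialIdeal I I (initialSpan a k) j := by
        refine h k hk j z hz ?_
        rw [initialIdeal, ← pow_succ']
        have : a ⟨k, hk⟩ * z = -v + (v + a ⟨k, hk⟩ * z) := by ring
        rw [this]
        exact add_mem (Ideal.mem_sup_left (neg_mem hv)) (Ideal.mem_sup_right huI')
      -- The part `p` of `z` is absorbed into the earlier generators, and `z'` has gained a power of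
      -- `I`. In degree zero `initialIdeal` is `I` itself, so `p = 0`.
      obtain ⟨p, hp, z', hz', rfl⟩ :
          ∃ p, a ⟨k, hk⟩ * p ∈ initialSpan a k * I ^ j ∧ ∃ z' ∈ I ^ (j + 1), p + z' = z := by
        cases j with
        | zero => exact ⟨0, by simp, z, by simpa [initialIdeal] using hzS, zero_add z⟩
        | succ j =>
          obtain ⟨p, hp, z', hz', rfl⟩ := Submodule.mem_sup.1 hzS
          refine ⟨p, ?_, z', by rwa [pow_succ' I (j + 1)], rfl⟩
          rw [pow_succ, ← mul_assoc, mul_comm (a _)]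
          exact Ideal.mul_mem_mul hp (ha _)
      have haz : a ⟨k, hk⟩ * z' ∈ I ^ (j + 1 + 1) := by
        rw [pow_succ']
        exact Ideal.mul_mem_mul (ha _) hz'
      have hv' : v + a ⟨k, hk⟩ * p ∈ initialSpan a k * I ^ (j + 1) := by
        refine ih (by omega) (j + 1) ⟨Ideal.mul_le_left (add_mem hv hp), ?_⟩
        have : v + a ⟨k, hk⟩ * p = v + a ⟨k, hk⟩ * (p + z') - a ⟨k, hk⟩ * z' := by ring
        rw [this]
        exact sub_mem huI' haz
      have : v + a ⟨k, hk⟩ * (p + z') = v + a ⟨k, hk⟩ * p + a ⟨k, hk⟩ * z' := by ring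
      rw [this]
      exact add_mem (Ideal.mul_mono_left (initialSpan_le_succ a k) hv')
        (Ideal.mul_mem_mul (apply_mem_initialSpan_succ a hk) hz')

/-- Krull's intersection theorem in `R ⧸ J`. -/
theorem mem_of_forall_mem_sup_pow [IsNoetherianRing R] [IsLocalRing R] (hI : I ≠ ⊤) {J : Ideal R}
    {z : R} (h : ∀ n, z ∈ J ⊔ I ^ n) : z ∈ J := by
  have := Ideal.iInf_pow_smul_eq_bot_of_isLocalRing (M := R ⧸ J) I hI
  rw [← Ideal.Quotient.eq_zero_iff_mem]
  refine (Submodule.mem_bot R).1 (this ▸ ?_)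
  refine (Submodule.mem_iInf _).2 fun n => ?_
  obtain ⟨p, hp, q, hq, rfl⟩ := Submodule.mem_sup.1 (h n)
  rw [map_add, Ideal.Quotient.eq_zero_iff_mem.2 hp, zero_add]
  have : Ideal.Quotient.mk J q = q • (1 : R ⧸ J) := by
    rw [Algebra.smul_def, mul_one]; rfl
  rw [this]
  exact Submodule.smul_mem_smul hq trivial

theorem isWeaklyRegular_of_initialIdeal [IsNoetherianRing R] [IsLocalRing R] (hI : I ≠ ⊤)
    (ha : ∀ i, a i ∈ I)
    (h : ∀ k (hk : k < r) n, ∀ z ∈ I ^ n, a ⟨k, hk⟩ * z ∈ initialIdeal I I (initialSpan a k) (n + 1) →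
      z ∈ initialIdeal I I (initialSpan a k) n) :
    IsWeaklyRegular R (List.ofFn a) := by
  rw [isWeaklyRegular_ofFn_iff]
  intro k hk z hz
  refine mem_of_forall_mem_sup_pow hI fun n => ?_
  -- Successive approximation: the error term `q ∈ I ^ n` satisfies `a_k q ∈ J_k ∩ I ^ (n + 1)`, so
  -- regularity in `G(I)` moves it into `J_k + I ^ (n + 1)`.
  induction n with
  | zero => simp
  | succ n ih =>
    obtain ⟨p, hp, q, hq, rfl⟩ := Submodule.mem_sup.1 ih
    have haq : a ⟨k, hk⟩ * q ∈ initialSpan a k * I ^ n := by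
      refine initialSpan_inf_pow_le ha h hk.le n ⟨?_, ?_⟩
      · rw [mul_add] at hz
        exact (Submodule.add_mem_iff_right _ (Ideal.mul_mem_left _ _ hp)).1 hz
      · rw [pow_succ']
        exact Ideal.mul_mem_mul (ha _) hq
    have hqS := h k hk n q hq (Ideal.mem_sup_left haq)
    refine add_mem (Ideal.mem_sup_left hp) ?_
    cases n with
    | zero => exact Ideal.mem_sup_right (by simpa [initialIdeal] using hqS)
    | succ n =>
      rw [initialIdeal, ← pow_succ'] at hqS
      exact sup_le_sup_right Ideal.mul_le_left (I ^ (n + 1 + 1)) hqS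

/-- If `(a₁, …, a_r) ∩ K I ^ (n + 1) = (a₁, …, a_r) K I ^ n` for all `n`, and `a` is weakly
regular, then the same holds for the initial segments of `a`. -/
theorem initialSpan_inf_mul_pow_le {K : Ideal R} (hIK : I ≤ K) (ha : ∀ i, a i ∈ I)
    (hreg : IsWeaklyRegular R (List.ofFn a))
    (h : ∀ n, initialSpan a r ⊓ K * I ^ (n + 1) ≤ initialSpan a r * (K * I ^ n))
    {k : ℕ} (hk : k ≤ r) (n : ℕ) :
    initialSpan a k ⊓ K * I ^ (n + 1) ≤ initialSpan a k * (K * I ^ n) := by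
  -- Descend in `k`, ascend in `n`: writing `u = v + a_k w`, weak regularity puts `w` in `J_k`, and
  -- the case of `n - 1` then controls `w`. For `n = 0`, `a_k ∈ I ≤ K` suffices.
  induction hk using Nat.decreasingInduction generalizing n with
  | self => exact h n
  | of_succ k hk ih =>
    induction n with
    | zero =>
      rintro u ⟨huJ, huK⟩
      have hu := ih 0 ⟨initialSpan_le_succ a k huJ, huK⟩
      rw [initialSpan_succ a hk, Ideal.sup_mul] at hu
      obtain ⟨v, hv, _, hw, rfl⟩ := Submodule.mem_sup.1 hu
      obtain ⟨w, hwK, rfl⟩ := Ideal.mem_span_singleton_mul.1 hw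
      refine add_mem hv ?_
      have := (isWeaklyRegular_ofFn_iff a).1 hreg k hk w
        ((Submodule.add_mem_iff_right _ (Ideal.mul_le_left hv)).1 huJ)
      rw [pow_zero, mul_one, mul_comm (a _)]
      exact Ideal.mul_mem_mul this (hIK (ha _))
    | succ n ihn =>
      rintro u ⟨huJ, huK⟩
      have hu := ih (n + 1) ⟨initialSpan_le_succ a k huJ, huK⟩
      rw [initialSpan_succ a hk, Ideal.sup_mul] at hu
      obtain ⟨v, hv, _, hw, rfl⟩ := Submodule.mem_sup.1 hu
      obtain ⟨w, hwK, rfl⟩ := Ideal.mem_span_singleton_mul.1 hw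
      refine add_mem hv ?_
      have := ihn ⟨(isWeaklyRegular_ofFn_iff a).1 hreg k hk w
        ((Submodule.add_mem_iff_right _ (Ideal.mul_le_left hv)).1 huJ), hwK⟩
      rw [pow_succ, ← mul_assoc, ← mul_assoc, mul_comm (a _), mul_assoc (initialSpan a k)]
      exact Ideal.mul_mem_mul this (ha _)

/-- The `K`-condition corrects `z` by some `w ∈ K I ^ n` so that `a_k (z - w) ∈ J_k`. Regularity in
`R` gives `z - w ∈ J_k`, and the `I`-condition places this difference in the right power. -/
theorem mem_initialIdeal_of_mul_mem {K : Ideal R} (hIK : I ≤ K) (ha : ∀ i, a i ∈ I)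
    (hreg : IsWeaklyRegular R (List.ofFn a))
    (hI : ∀ k ≤ r, ∀ n, initialSpan a k ⊓ I ^ (n + 1) ≤ initialSpan a k * I ^ n)
    (hK : ∀ n, initialSpan a r ⊓ K * I ^ (n + 1) ≤ initialSpan a r * (K * I ^ n))
    {k : ℕ} (hk : k < r) {n : ℕ} {z : R} (hz : z ∈ I ^ n)
    (h : a ⟨k, hk⟩ * z ∈ initialIdeal K I (initialSpan a k) (n + 1)) :
    z ∈ initialIdeal K I (initialSpan a k) n := by
  obtain ⟨v, hv, u, hu, huv⟩ := Submodule.mem_sup.1 h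
  have hu' : u ∈ initialSpan a (k + 1) * (K * I ^ n) := by
    refine initialSpan_inf_mul_pow_le hIK ha hreg hK hk n ⟨?_, hu⟩
    rw [← eq_sub_iff_add_eq'] at huv
    rw [huv]
    exact sub_mem (Ideal.mul_mem_right _ _ (apply_mem_initialSpan_succ a hk))
      (initialSpan_le_succ a k (Ideal.mul_le_left hv))
  rw [initialSpan_succ a hk, Ideal.sup_mul] at hu'
  obtain ⟨v', hv', _, hw, rfl⟩ := Submodule.mem_sup.1 hu'
  obtain ⟨w, hwK, rfl⟩ := Ideal.mem_span_singleton_mul.1 hw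
  have hzw : z - w ∈ initialSpan a k := by
    refine (isWeaklyRegular_ofFn_iff a).1 hreg k hk _ ?_
    have : a ⟨k, hk⟩ * (z - w) = v + v' := by rw [mul_sub, ← huv]; ring
    rw [this]
    exact add_mem (Ideal.mul_le_left hv) (Ideal.mul_le_left hv')
  rw [← sub_add_cancel z w]
  refine add_mem ?_ (mul_pow_le_initialIdeal K I _ n hwK)
  cases n with
  | zero => exact hIK (initialSpan_le a ha k hzw)
  | succ n =>
    exact Ideal.mem_sup_left (hI k hk.le n ⟨hzw, sub_mem hz (Ideal.mul_le_right hwK)⟩)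

end Filtration

/-! ### Intersections with `m I ^ (n + 1)` -/

section LocalRing

open IsLocalRing

variable {R : Type*} [CommRing R] [IsLocalRing R]

theorem radical_eq_maximalIdeal_of_mul_pow_le {I Q : Ideal R} (hI : I.radical = maximalIdeal R)
    (hQ : Q ≤ maximalIdeal R) (h : maximalIdeal R * I ^ 2 ≤ Q) :
    Q.radical = maximalIdeal R := by
  refine le_antisymm ((Ideal.radical_mono hQ).trans (Ideal.IsPrime.radical inferInstance).le) ?_
  have : (maximalIdeal R * I ^ 2).radical = maximalIdeal R := by
    rw [Ideal.radical_mul, Ideal.radical_pow I two_ne_zero, hI,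
      (Ideal.IsPrime.radical inferInstance : (maximalIdeal R).radical = _), inf_idem]
  exact this.symm.le.trans (Ideal.radical_mono h)

theorem ringKrullDim_le_ncard_of_radical_eq [IsNoetherianRing R] {s : Set R} (hs : s.Finite)
    (h : (Ideal.span s).radical = maximalIdeal R) : ringKrullDim R ≤ s.ncard := by
  rw [← maximalIdeal_height_eq_ringKrullDim]
  have : maximalIdeal R ∈ (Ideal.span s).minimalPrimes := by
    rw [← Ideal.radical_minimalPrimes, h, Ideal.minimalPrimes_eq_subsingleton_self]
    rfl
  exact_mod_cast Ideal.height_le_card_of_mem_minimalPrimes_span hs this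

variable {I : Ideal R} {r : ℕ} {a : Fin r → R} {x : R}

/-- If `m I ^ 2 = x I ^ 2 + (a) m I` and `dim R > r`, then `a₁, …, a_r` are linearly independent
in `I / m I`. -/
theorem span_inf_maximalIdeal_mul_le [IsNoetherianRing R] (hdim : (r : WithBot ℕ∞) < ringKrullDim R)
    (hI : I.radical = maximalIdeal R) (ha : ∀ i, a i ∈ I) (hx : x ∈ maximalIdeal R)
    (hred : maximalIdeal R * I ^ 2 =
      Ideal.span {x} * I ^ 2 + Ideal.span (Set.range a) * maximalIdeal R * I) :
    Ideal.span (Set.range a) ⊓ maximalIdeal R * I ≤ Ideal.span (Set.range a) * maximalIdeal R := by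
  have hIm : I ≤ maximalIdeal R := Ideal.le_radical.trans hI.le
  rintro u ⟨hu, huI⟩
  obtain ⟨c, rfl⟩ := Ideal.mem_span_range_iff_exists_fun.1 hu
  refine sum_mem fun j _ => ?_
  rw [mul_comm (c j)]
  refine Ideal.mul_mem_mul (Ideal.subset_span (Set.mem_range_self j)) ?_
  -- A coefficient outside `m` is a unit, so `a j` can be eliminated modulo `m I`.
  by_contra hc
  set J' : Ideal R := Ideal.span (a '' {j}ᶜ)
  have hJ' {i : Fin r} (hi : i ≠ j) : a i ∈ J' := Ideal.subset_span (Set.mem_image_of_mem a hi)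
  have hunit : IsUnit (c j) := by simpa using hc
  have haj : a j ∈ J' ⊔ maximalIdeal R * I := by
    have : c j * a j ∈ J' ⊔ maximalIdeal R * I := by
      rw [← Finset.add_sum_erase _ _ (Finset.mem_univ j)] at huI
      rw [← add_sub_cancel_right (c j * a j)]
      exact sub_mem (Ideal.mem_sup_right huI) (Ideal.mem_sup_left (sum_mem fun i hi =>
        Ideal.mul_mem_left _ _ (hJ' (Finset.ne_of_mem_erase hi))))
    exact (Ideal.unit_mul_mem_iff_mem _ hunit).1 this
  have hJ : Ideal.span (Set.range a) ≤ J' ⊔ maximalIdeal R * I := by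
    refine Ideal.span_le.2 ?_
    rintro _ ⟨i, rfl⟩
    by_cases hi : i = j
    · exact hi ▸ haj
    · exact Ideal.mem_sup_left (hJ' hi)
  have hQ : Ideal.span (insert x (a '' {j}ᶜ)) = Ideal.span {x} ⊔ J' := Ideal.span_insert _ _
  have hle : maximalIdeal R * I ^ 2 ≤ Ideal.span (insert x (a '' {j}ᶜ)) := by
    -- Nakayama: the leftover term of `J m I` is `(m I) m I = m (m I ^ 2)`.
    refine Submodule.le_of_le_smul_of_le_jacobson_bot (IsNoetherian.noetherian _)
      (maximalIdeal_le_jacobson (⊥ : Ideal R)) ?_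
    refine hred.le.trans ?_
    rw [hQ, smul_eq_mul]
    refine sup_le (Ideal.mul_le_left.trans (le_sup_left.trans le_sup_left)) ?_
    rw [mul_assoc]
    refine (Ideal.mul_mono_left hJ).trans ?_
    rw [Ideal.sup_mul]
    refine sup_le_sup (Ideal.mul_le_left.trans le_sup_right) (le_of_eq ?_)
    ring
  have hrad := radical_eq_maximalIdeal_of_mul_pow_le hI (Ideal.span_le.2 (by
    rintro y (hy | ⟨i, -, rfl⟩)
    exacts [hy ▸ hx, hIm (ha i)])) hle
  refine absurd (ringKrullDim_le_ncard_of_radical_eq (Set.toFinite _) hrad) (not_le.2 ?_)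
  refine lt_of_le_of_lt ?_ hdim
  -- Adding `x` compensates for dropping `a j`, leaving at most `r < dim R` generators.
  have h1 : (insert x (a '' {j}ᶜ)).ncard ≤ r := by
    refine (Set.ncard_insert_le _ _).trans ?_
    have h2 := Set.ncard_image_le (f := a) (Set.toFinite {j}ᶜ)
    have h3 := Set.ncard_add_ncard_compl {j}
    rw [Set.ncard_singleton, Nat.card_fin] at h3
    omega
  exact_mod_cast h1

theorem span_inf_maximalIdeal_mul_pow_le (hx : x ∈ maximalIdeal R)
    (hxJ : ∀ z, x * z ∈ Ideal.span (Set.range a) → z ∈ Ideal.span (Set.range a))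
    (hI : ∀ n, Ideal.span (Set.range a) ⊓ I ^ (n + 1) ≤ Ideal.span (Set.range a) * I ^ n)
    (hred : maximalIdeal R * I ^ 2 =
      Ideal.span {x} * I ^ 2 + Ideal.span (Set.range a) * maximalIdeal R * I) (n : ℕ) :
    Ideal.span (Set.range a) ⊓ maximalIdeal R * I ^ (n + 2) ≤
      Ideal.span (Set.range a) * (maximalIdeal R * I ^ (n + 1)) := by
  have h : maximalIdeal R * I ^ (n + 2) =
      Ideal.span {x} * I ^ (n + 2) ⊔ Ideal.span (Set.range a) * (maximalIdeal R * I ^ (n + 1)) := by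
    calc maximalIdeal R * I ^ (n + 2) = maximalIdeal R * I ^ 2 * I ^ n := by ring
      _ = _ := by rw [hred, ← Submodule.add_eq_sup]; ring
  rintro u ⟨huJ, hu⟩
  rw [h] at hu
  obtain ⟨_, hv, w, hw, rfl⟩ := Submodule.mem_sup.1 hu
  obtain ⟨y, hy, rfl⟩ := Ideal.mem_span_singleton_mul.1 hv
  refine add_mem ?_ hw
  have hyJ := hI (n + 1) ⟨hxJ y ((Submodule.add_mem_iff_left _ (Ideal.mul_le_left hw)).1 huJ), hy⟩
  rw [mul_left_comm]
  exact Ideal.mul_mem_mul hx hyJ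

end LocalRing

/-! ### Translation to the graded rings -/

section Graded

variable {R : Type*} [CommRing R] {K I : Ideal R}

theorem blowupRing_add_mul (f g h : BlowupRing K I) : (f + g) * h = f * h + g * h :=
  (inferInstance : CommRing (BlowupRing K I)).right_distrib f g h

theorem blowupRing_zero_mul (f : BlowupRing K I) : 0 * f = 0 :=
  zero_mul f

theorem blowupRing_mul_comm (f g : BlowupRing K I) : f * g = g * f :=
  mul_comm f g

theorem mul_degreeOne_apply_zero (g : BlowupRing K I) (a : R) (ha : a ∈ I) :
    (g * degreeOne K I a ha) 0 = 0 := by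
  induction g using DirectSum.induction_on with
  | zero => rw [blowupRing_zero_mul]; rfl
  | of i y =>
    rw [degreeOne, DirectSum.of_mul_of]
    exact DirectSum.of_eq_of_ne _ _ _ (by omega)
  | add f g hf hg => rw [blowupRing_add_mul, DirectSum.add_apply, hf, hg, add_zero]

theorem mul_degreeOne_apply_succ (g : BlowupRing K I) (a : R) (ha : a ∈ I) (n : ℕ) :
    (g * degreeOne K I a ha) (n + 1) =
      Piece.mul K I (g n) (Piece.mk K I 1 ⟨a, by rwa [pow_one]⟩) := by
  induction g using DirectSum.induction_on with
  | zero =>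
    rw [blowupRing_zero_mul]
    exact (DirectSum.GNonUnitalNonAssocSemiring.zero_mul (A := Piece K I) _).symm
  | of i y =>
    rw [degreeOne, DirectSum.of_mul_of]
    by_cases h : i = n
    · subst h
      rw [DirectSum.of_eq_same, DirectSum.of_eq_same]
      rfl
    · rw [DirectSum.of_eq_of_ne _ _ _ (by omega), DirectSum.of_eq_of_ne _ _ _ (by omega)]
      exact (DirectSum.GNonUnitalNonAssocSemiring.zero_mul (A := Piece K I) _).symm
  | add f g hf hg =>
    rw [blowupRing_add_mul, DirectSum.add_apply, DirectSum.add_apply, hf, hg]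
    exact (DirectSum.GNonUnitalNonAssocSemiring.add_mul (A := Piece K I) _ _ _).symm

variable {r : ℕ} {a : Fin r → R} (ha : ∀ i, a i ∈ I)

/-- Multiplication by a degree one class shifts degrees by one, so membership is tracked in each
component; nothing is contributed in degree zero. -/
theorem exists_rep_of_mem_initialSpan_degreeOne {k : ℕ} (hk : k ≤ r) {f : BlowupRing K I}
    (hf : f ∈ initialSpan (fun i => degreeOne K I (a i) (ha i)) k) (n : ℕ) :
    ∃ z, ∃ hz : z ∈ I ^ n, f n = Piece.mk K I n ⟨z, hz⟩ ∧
      z ∈ initialIdeal K I (initialSpan a k) n := by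
  induction k generalizing f n with
  | zero =>
    rw [initialSpan_zero, Ideal.mem_bot] at hf
    exact ⟨0, zero_mem _, by rw [hf]; rfl, zero_mem _⟩
  | succ k ih =>
    rw [initialSpan_succ _ hk] at hf
    obtain ⟨g, hg, _, hq, rfl⟩ := Submodule.mem_sup.1 hf
    obtain ⟨q, rfl⟩ := Ideal.mem_span_singleton'.1 hq
    obtain ⟨z, hz, hgz, hzS⟩ := ih (by omega) hg n
    rw [DirectSum.add_apply, hgz]
    cases n with
    | zero =>
      rw [mul_degreeOne_apply_zero, add_zero]
      exact ⟨z, hz, rfl, hzS⟩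
    | succ n =>
      obtain ⟨w, hw⟩ := Piece.mk_surjective K I n (q n)
      rw [mul_degreeOne_apply_succ, ← hw, Piece.mk_mul_mk]
      refine ⟨z + w * a ⟨k, hk⟩, add_mem hz ?_, rfl, add_mem ?_ ?_⟩
      · rw [pow_succ]
        exact Ideal.mul_mem_mul w.2 (ha _)
      · exact sup_le_sup_right (Ideal.mul_mono_left (initialSpan_le_succ a k)) _ hzS
      · rw [mul_comm]
        exact Ideal.mem_sup_left
          (Ideal.mul_mem_mul (apply_mem_initialSpan_succ a hk) w.2)

theorem of_mk_mem_initialSpan_degreeOne_of_mem_mul {k : ℕ} (hk : k ≤ r) {n : ℕ} {z : R}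
    (hz : z ∈ I ^ (n + 1)) (h : z ∈ initialSpan a k * I ^ n) :
    DirectSum.of (Piece K I) (n + 1) (Piece.mk K I (n + 1) ⟨z, hz⟩) ∈
      initialSpan (fun i => degreeOne K I (a i) (ha i)) k := by
  induction k generalizing z with
  | zero =>
    rw [initialSpan_zero, Ideal.bot_mul, Ideal.mem_bot] at h
    subst h
    rw [show Piece.mk K I (n + 1) ⟨0, hz⟩ = 0 from rfl, map_zero]
    exact zero_mem _
  | succ k ih =>
    rw [initialSpan_succ a hk, Ideal.sup_mul] at h
    obtain ⟨v, hv, _, hw, rfl⟩ := Submodule.mem_sup.1 h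
    obtain ⟨w, hwI, rfl⟩ := Ideal.mem_span_singleton_mul.1 hw
    have hvI : v ∈ I ^ (n + 1) := by
      rw [pow_succ']
      exact Ideal.mul_mono_left (initialSpan_le a ha k) hv
    have : DirectSum.of (Piece K I) (n + 1)
        (Piece.mk K I (n + 1) ⟨v + a ⟨k, hk⟩ * w, hz⟩) =
        DirectSum.of (Piece K I) (n + 1) (Piece.mk K I (n + 1) ⟨v, hvI⟩) +
        DirectSum.of (Piece K I) n (Piece.mk K I n ⟨w, hwI⟩) *
          degreeOne K I (a ⟨k, hk⟩) (ha _) := by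
      rw [degreeOne, DirectSum.of_mul_of, ← map_add]
      refine congrArg _ ((Piece.mk_eq_mk_iff K I _
        (⟨v, hvI⟩ + powMul I ⟨w, hwI⟩ ⟨a ⟨k, hk⟩, _⟩)).2 ?_)
      simp [powMul, mul_comm]
    rw [this]
    exact add_mem (initialSpan_le_succ _ k (ih (by omega) hvI hv))
      (Ideal.mul_mem_left _ _ (apply_mem_initialSpan_succ
        (fun i => degreeOne K I (a i) (ha i)) hk))

theorem of_mk_mem_initialSpan_degreeOne {k : ℕ} (hk : k ≤ r) {n : ℕ} {z : R}
    (hz : z ∈ I ^ n) (h : z ∈ initialIdeal K I (initialSpan a k) n) :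
    DirectSum.of (Piece K I) n (Piece.mk K I n ⟨z, hz⟩) ∈
      initialSpan (fun i => degreeOne K I (a i) (ha i)) k := by
  cases n with
  | zero =>
    rw [show Piece.mk K I 0 ⟨z, hz⟩ = 0 from
      (Piece.mk_eq_mk_iff K I ⟨z, hz⟩ 0).2 (by simpa [initialIdeal] using h), map_zero]
    exact zero_mem _
  | succ n =>
    obtain ⟨p, hp, q, hq, rfl⟩ := Submodule.mem_sup.1 h
    have hpI : p ∈ I ^ (n + 1) := (Submodule.add_mem_iff_left _ (Ideal.mul_le_right hq)).1 hz
    rw [show Piece.mk K I (n + 1) ⟨p + q, hz⟩ = Piece.mk K I (n + 1) ⟨p, hpI⟩ from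
      (Piece.mk_eq_mk_iff K I _ _).2 (by simpa using hq)]
    exact of_mk_mem_initialSpan_degreeOne_of_mem_mul ha hk hpI hp

theorem mem_initialIdeal_of_mk_eq {J : Ideal R} {n : ℕ} {y z : R} (hy : y ∈ I ^ n)
    (hz : z ∈ I ^ n) (h : Piece.mk K I n ⟨y, hy⟩ = Piece.mk K I n ⟨z, hz⟩)
    (hzS : z ∈ initialIdeal K I J n) : y ∈ initialIdeal K I J n := by
  rw [← sub_add_cancel y z]
  exact add_mem (mul_pow_le_initialIdeal K I J n ((Piece.mk_eq_mk_iff K I _ _).1 h)) hzS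

/-- Regularity of a sequence of degree one elements of `⨁ n, I ^ n / K I ^ n`, expressed by
homogeneous elements. -/
theorem isWeaklyRegular_degreeOne_iff :
    IsWeaklyRegular (BlowupRing K I) (List.ofFn fun i => degreeOne K I (a i) (ha i)) ↔
      ∀ k (hk : k < r) n, ∀ z ∈ I ^ n,
        a ⟨k, hk⟩ * z ∈ initialIdeal K I (initialSpan a k) (n + 1) →
        z ∈ initialIdeal K I (initialSpan a k) n := by
  rw [isWeaklyRegular_ofFn_iff]
  constructor
  · intro h k hk n z hz haz
    have hazI : z * a ⟨k, hk⟩ ∈ I ^ (n + 1) := by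
      rw [pow_succ]
      exact Ideal.mul_mem_mul hz (ha _)
    have hmem := h k hk (DirectSum.of (Piece K I) n (Piece.mk K I n ⟨z, hz⟩)) (by
      rw [blowupRing_mul_comm, degreeOne, DirectSum.of_mul_of]
      exact of_mk_mem_initialSpan_degreeOne ha hk.le hazI (by rwa [mul_comm]))
    obtain ⟨y, hy, hzy, hyS⟩ := exists_rep_of_mem_initialSpan_degreeOne ha hk.le hmem n
    rw [DirectSum.of_eq_same] at hzy
    exact mem_initialIdeal_of_mk_eq hz hy hzy hyS
  · intro h k hk f hf
    classical
    rw [← DirectSum.sum_support_of f]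
    -- The ideal is generated by homogeneous elements, so the components of `f` are tested
    -- separately.
    refine sum_mem fun n _ => ?_
    obtain ⟨⟨z, hz⟩, hfz⟩ := Piece.mk_surjective K I n (f n)
    rw [← hfz]
    refine of_mk_mem_initialSpan_degreeOne ha hk.le hz (h k hk n z hz ?_)
    rw [blowupRing_mul_comm] at hf
    obtain ⟨y, hy, hzy, hyS⟩ := exists_rep_of_mem_initialSpan_degreeOne ha hk.le hf (n + 1)
    rw [mul_degreeOne_apply_succ, ← hfz, Piece.mk_mul_mk] at hzy
    rw [mul_comm]
    exact mem_initialIdeal_of_mk_eq _ hy hzy hyS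

/-- If the sequence generated the unit ideal, the degree zero component of `1` would force `1 ∈ K`.
-/
theorem isRegular_degreeOne (hK : K ≠ ⊤)
    (h : IsWeaklyRegular (BlowupRing K I) (List.ofFn fun i => degreeOne K I (a i) (ha i))) :
    IsRegular (BlowupRing K I) (List.ofFn fun i => degreeOne K I (a i) (ha i)) := by
  refine ⟨h, fun htop => (Ideal.ne_top_iff_one K).1 hK ?_⟩
  have h1 : (1 : BlowupRing K I) ∈ initialSpan (fun i => degreeOne K I (a i) (ha i)) r := by
    rw [← ofList_take_ofFn, List.take_of_length_le (by simp)]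
    have : (1 : BlowupRing K I) ∈ (⊤ : Ideal (BlowupRing K I)) := trivial
    rwa [htop, smul_eq_mul, Ideal.mul_top] at this
  obtain ⟨z, hz, h1z, hzS⟩ := exists_rep_of_mem_initialSpan_degreeOne ha le_rfl h1 0
  exact mem_initialIdeal_of_mk_eq (y := 1) (by simp) hz
    (Eq.trans (DirectSum.of_eq_same (β := Piece K I) 0 _).symm h1z) hzS

theorem degreeOne_mem_irrelevantIdeal (b : R) (hb : b ∈ I) :
    degreeOne K I b hb ∈ irrelevantIdeal K I :=
  Ideal.subset_span ⟨1, _, one_pos, rfl⟩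

end Graded

/-! ### Depth bounds and conclusion -/

theorem le_depth {A : Type*} [CommRing A] {𝔞 : Ideal A} {rs : List A} (h : IsRegular A rs)
    (hrs : ∀ r ∈ rs, r ∈ 𝔞) : (rs.length : ℕ∞) ≤ depth 𝔞 :=
  le_iSup₂_of_le rs ⟨h, hrs⟩ le_rfl

theorem exists_isRegular_of_lt_depth {A : Type*} [CommRing A] {𝔞 : Ideal A} {n : ℕ}
    (h : (n : ℕ∞) < depth 𝔞) :
    ∃ rs : List A, rs.length = n + 1 ∧ (∀ r ∈ rs, r ∈ 𝔞) ∧ IsWeaklyRegular A rs := by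
  obtain ⟨rs, hrs⟩ := lt_iSup_iff.1 h
  obtain ⟨⟨hreg, hmem⟩, hlt⟩ := lt_iSup_iff.1 hrs
  have hlt : n < rs.length := by exact_mod_cast hlt
  refine ⟨rs.take (n + 1), by simp; omega, fun r hr => hmem r (List.mem_of_mem_take hr), ?_⟩
  have := hreg.toIsWeaklyRegular
  rw [← List.take_append_drop (n + 1) rs, isWeaklyRegular_append_iff] at this
  exact this.1

theorem mainTheorem6 {R : Type*} [CommRing R] [IsLocalRing R]
    (hR : BlowupAlgebra.IsCohenMacaulayLocal R)
    (d : ℕ) (hd : 2 ≤ d) (hdim : ringKrullDim R = d)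
    (I : Ideal R) (hI : I.IsPrimary) (hIm : I.radical = IsLocalRing.maximalIdeal R)
    (x : R) (a : Fin (d - 1) → R) (ha : ∀ i, a i ∈ I)
    (hjoint : BlowupAlgebra.IsJointReduction
      (Fin.cons (IsLocalRing.maximalIdeal R) (fun _ => I) : Fin (d - 1 + 1) → Ideal R)
      (Fin.cons x a : Fin (d - 1 + 1) → R))
    (hred : IsLocalRing.maximalIdeal R * I ^ 2 =
      Ideal.span {x} * I ^ 2 + Ideal.span (Set.range a) * IsLocalRing.maximalIdeal R * I)
    (hreg : RingTheory.Sequence.IsRegular (BlowupAlgebra.AssociatedGraded I)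
      (List.ofFn fun i => BlowupAlgebra.initialForm I (a i) (ha i))) :
    ((d - 1 : ℕ) : ℕ∞) ≤ BlowupAlgebra.fiberConeDepth I := by
  have := hR.noetherian
  have hx : x ∈ IsLocalRing.maximalIdeal R := hjoint.1 0
  have hIle : I ≤ IsLocalRing.maximalIdeal R := Ideal.le_radical.trans hIm.le
  have hdepth : ((d - 1 : ℕ) : ℕ∞) < depth (IsLocalRing.maximalIdeal R) := by
    have h : depth (IsLocalRing.maximalIdeal R) = (d : ℕ∞) := by
      exact_mod_cast hR.depth_eq.trans hdim
    rw [h]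
    exact_mod_cast (by omega : d - 1 < d)
  have hdim' : ((d - 1 : ℕ) : WithBot ℕ∞) < ringKrullDim R := by
    rw [hdim]
    exact_mod_cast (by omega : d - 1 < d)
  have hG := (isWeaklyRegular_degreeOne_iff ha).1 hreg.toIsWeaklyRegular
  have hareg := isWeaklyRegular_of_initialIdeal hI.ne_top ha hG
  have hVV (k) (hk : k ≤ d - 1) (n) := initialSpan_inf_pow_le ha hG hk n
  have hlist : Ideal.ofList (List.ofFn a) = Ideal.span (Set.range a) := by
    rw [← initialSpan_eq_span_range, ← ofList_take_ofFn, List.take_of_length_le (by simp)]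
  have hrad : (Ideal.span {x} ⊔ Ideal.ofList (List.ofFn a)).radical =
      IsLocalRing.maximalIdeal R := by
    rw [hlist]
    refine radical_eq_maximalIdeal_of_mul_pow_le hIm (sup_le ?_ ?_) ?_
    · exact (Ideal.span_singleton_le_iff_mem _).2 hx
    · exact Ideal.span_le.2 (by rintro _ ⟨i, rfl⟩; exact hIle (ha i))
    · rw [hred, Submodule.add_eq_sup, mul_assoc]
      exact sup_le_sup Ideal.mul_le_left Ideal.mul_le_left
  obtain ⟨rs, hlen, hrs, hrsreg⟩ := exists_isRegular_of_lt_depth hdepth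
  have hxJ (z : R) (hz : x * z ∈ Ideal.span (Set.range a)) : z ∈ Ideal.span (Set.range a) := by
    rw [← hlist] at hz ⊢
    refine mem_ofList_of_mul_mem hareg hrad ⟨rs, by simpa using hlen, hrs, ?_⟩ hz
    -- Truncation kept only weak regularity; properness returns because the entries lie in `m`.
    exact IsRegular.of_isWeaklyRegular_of_mem_maximalIdeal R hrs hrsreg
  have hK (n : ℕ) : initialSpan a (d - 1) ⊓ IsLocalRing.maximalIdeal R * I ^ (n + 1) ≤
      initialSpan a (d - 1) * (IsLocalRing.maximalIdeal R * I ^ n) := by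
    have hVV' := hVV (d - 1) le_rfl
    rw [initialSpan_eq_span_range] at hVV' ⊢
    -- The reduction equation starts at `I ^ 2`, so `m I` needs the separate dimension argument.
    cases n with
    | zero => simpa using span_inf_maximalIdeal_mul_le hdim' hIm ha hx hred
    | succ n => exact span_inf_maximalIdeal_mul_pow_le hx hxJ hVV' hred n
  have hF : IsWeaklyRegular (FiberCone I)
      (List.ofFn fun i => degreeOne (IsLocalRing.maximalIdeal R) I (a i) (ha i)) :=
    (isWeaklyRegular_degreeOne_iff ha).2 fun k hk n z hz =>
      mem_initialIdeal_of_mul_mem hIle ha hareg hVV hK hk hz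
  have hle := le_depth (isRegular_degreeOne ha Ideal.IsPrime.ne_top' hF)
    (𝔞 := irrelevantIdeal (IsLocalRing.maximalIdeal R) I) (by
      rw [List.forall_mem_ofFn_iff]
      exact fun i => degreeOne_mem_irrelevantIdeal (a i) (ha i))
  rwa [List.length_ofFn] at hle
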